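/- Let $n \ge 2$ and let $S_1,\dots,S_n$ be isometries on an infinite-dimensional complex Hilbert space $H$ with $\sum_{i=1}^n S_iS_i^*=1_H$. Let $O_n\subset B(H)$ be the C$^*$-algebra generated by $S_1,\dots,S_n$ (the Cuntz algebra). For a word $\mu=(\mu_1,\dots,\mu_k)$ in $\{1,\dots,n\}$ put $S_\mu=S_{\mu_1}\cdots S_{\mu_k}$ (with $S_\emptyset=1$), let $F_n^k$ be the linear span of all $S_\mu S_\nu^*$ with $\mu,\nu$ words of length $k$, and let $F_n\subset O_n$ be the norm closure of $\bigcup_{k\ge 0}F_n^k$ (the UHF subalgebra). Let $$\Phi_n(x)=\sum_{i=1}^n S_ixS_i^*,\qquad \Psi_n(x)=\frac1n\sum_{i=1}^n S_i^*xS_i\qquad(x\in O_n)$$ be the canonical $*$-endomorphism of $O_n$ and its standard left inverse. There is exactly one state $\phi_n$ of $O_n$ with the trace-like property $\phi_n(ab)=\phi_n(ba)$ for all $a\in O_n$, $b\in F_n$, and it satisfies the following. (i) $\Phi_n$ preserves $\phi_n$, that is, $\phi_n\circ\Phi_n=\phi_n$. (ii) $\Psi_n$ is the adjoint map of $\Phi_n$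 with respect to $\langle x,y\rangle=\phi_n(y^*x)$, that is, $\langle\Phi_n(x),y\rangle=\langle x,\Psi_n(y)\rangle$ for all $x,y\in O_n$. -/

import Mathlib

open scoped ComplexOrder

namespace Cuntz

section Generators

variable {H : Type*} [NormedAddCommGroup H] [InnerProductSpace ℂ H] [CompleteSpace H]

/-- A Cuntz family: isometries `S 1, …, S n` on `H` with `∑ i, S i * (S i)^* = 1`. -/
structure IsCuntzFamily {n : ℕ} (S : Fin n → (H →L[ℂ] H)) : Prop where
  isometry : ∀ i, star (S i) * S i = 1
  sum_range : ∑ i, S i * star (S i) = 1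

/-- The Cuntz algebra `O_n`: the C*-subalgebra of `B(H)` generated by `S 1, …, S n`. -/
noncomputable def algebra {n : ℕ} (S : Fin n → (H →L[ℂ] H)) : StarSubalgebra ℂ (H →L[ℂ] H) :=
  (StarAlgebra.adjoin ℂ (Set.range S)).topologicalClosure

variable {n : ℕ} (S : Fin n → (H →L[ℂ] H))

theorem mem_algebra (i : Fin n) : S i ∈ algebra S :=
  StarSubalgebra.le_topologicalClosure _ (StarAlgebra.subset_adjoin ℂ _ ⟨i, rfl⟩)

/-- The generator `S i`, as an element of `O_n`. -/
noncomputable def gen (i : Fin n) : algebra S := ⟨S i, mem_algebra S i⟩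

/-- The word `S_μ = S_{μ_1} ⋯ S_{μ_k}` in `O_n`. -/
noncomputable def word {k : ℕ} (μ : Fin k → Fin n) : algebra S :=
  (List.ofFn fun j => gen S (μ j)).prod

/-- `F_n^k`: the linear span of all `S_μ S_ν^*` with `μ`, `ν` words of length `k`. -/
noncomputable def uhfLevel (k : ℕ) : Submodule ℂ (algebra S) :=
  Submodule.span ℂ {x | ∃ μ ν : Fin k → Fin n, x = word S μ * star (word S ν)}

/-- The UHF subalgebra `F_n`: the norm closure in `O_n` of the union of the `F_n^k`. -/
noncomputable def uhf : Set (algebra S) :=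
  closure (⋃ k : ℕ, (uhfLevel S k : Set (algebra S)))

/-- A state of `O_n`: a positive linear functional with value `1` at the unit. -/
structure IsState (φ : algebra S →ₗ[ℂ] ℂ) : Prop where
  nonneg : ∀ x, 0 ≤ φ (star x * x)
  map_one : φ 1 = 1

/-- `φ` is a state with the trace-like property `φ (a b) = φ (b a)`, `a ∈ O_n`, `b ∈ F_n`. -/
structure IsCanonicalState (φ : algebra S →ₗ[ℂ] ℂ) : Prop where
  isState : IsState S φ
  trace_like : ∀ a, ∀ b ∈ uhf S, φ (a * b) = φ (b * a)

variable {S}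

theorem IsCuntzFamily.star_mul_of_ne (hS : IsCuntzFamily S) {i j : Fin n} (hij : i ≠ j) :
    star (S i) * S j = 0 := by
  have key : ∀ (k : Fin n) (x : H), ‖S k x‖ ^ 2 = ‖x‖ ^ 2 := by
    intro k x
    have h1 : star (S k) (S k x) = x := by
      have := congrArg (fun T : H →L[ℂ] H => T x) (hS.isometry k)
      simpa using this
    rw [ContinuousLinearMap.star_eq_adjoint] at h1
    have h2 := ContinuousLinearMap.adjoint_inner_right (S k) x (S k x)
    rw [h1, inner_self_eq_norm_sq_to_K, inner_self_eq_norm_sq_to_K] at h2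
    exact_mod_cast h2.symm
  ext x
  have hsum : ∑ k, ‖star (S k) (S j x)‖ ^ 2 = ‖S j x‖ ^ 2 := by
    have h1 : (∑ k, S k (star (S k) (S j x))) = S j x := by
      have := congrArg (fun T : H →L[ℂ] H => T (S j x)) hS.sum_range
      simpa [sum_apply] using this
    have h2 : inner ℂ (S j x) (∑ k, S k (star (S k) (S j x))) = inner ℂ (S j x) (S j x) := by
      rw [h1]
    rw [inner_sum, inner_self_eq_norm_sq_to_K] at h2
    have h3 : ∀ k, inner ℂ (S j x) (S k (star (S k) (S j x)))
        = ((‖star (S k) (S j x)‖ : ℂ)) ^ 2 := by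
      intro k
      rw [ContinuousLinearMap.star_eq_adjoint, ← ContinuousLinearMap.adjoint_inner_left,
        inner_self_eq_norm_sq_to_K]
      rfl
    simp only [h3] at h2
    refine Complex.ofReal_injective ?_
    push_cast
    exact h2
  have hj : ‖star (S j) (S j x)‖ ^ 2 = ‖S j x‖ ^ 2 := by
    have h1 : star (S j) (S j x) = x := by
      have := congrArg (fun T : H →L[ℂ] H => T x) (hS.isometry j)
      simpa using this
    rw [h1, key]
  have hle : ‖star (S i) (S j x)‖ ^ 2 + ‖star (S j) (S j x)‖ ^ 2
      ≤ ∑ k, ‖star (S k) (S j x)‖ ^ 2 := by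
    rw [← Finset.sum_pair (f := fun k => ‖star (S k) (S j x)‖ ^ 2) hij]
    exact Finset.sum_le_sum_of_subset_of_nonneg (Finset.subset_univ _)
      (fun _ _ _ => sq_nonneg _)
  have h0 : ‖star (S i) (S j x)‖ ^ 2 = 0 :=
    le_antisymm (by linarith) (sq_nonneg _)
  have : star (S i) (S j x) = 0 := by simpa using h0
  simpa using this

theorem IsCuntzFamily.star_gen_mul_gen (hS : IsCuntzFamily S) (i j : Fin n) :
    star (gen S i) * gen S j = if i = j then 1 else 0 := by
  apply Subtype.ext
  by_cases h : i = j
  · subst h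
    simpa [gen] using hS.isometry i
  · simpa [gen, h] using hS.star_mul_of_ne h

theorem IsCuntzFamily.sum_gen_mul_star (hS : IsCuntzFamily S) :
    ∑ i, gen S i * star (gen S i) = 1 := by
  apply Subtype.ext
  simpa [gen] using hS.sum_range

/-- Cuntz's canonical *-endomorphism `Φ_n x = ∑ i, S_i x S_i^*` of `O_n`. -/
noncomputable def canonicalEndo (hS : IsCuntzFamily S) : algebra S →⋆ₐ[ℂ] algebra S where
  toFun x := ∑ i, gen S i * x * star (gen S i)
  map_one' := by simpa using hS.sum_gen_mul_star
  map_zero' := by simp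
  map_add' x y := by simp [mul_add, add_mul, Finset.sum_add_distrib]
  map_mul' x y := by
    rw [Finset.sum_mul_sum]
    refine Finset.sum_congr rfl fun i _ => ?_
    have h : ∀ j, gen S i * x * star (gen S i) * (gen S j * y * star (gen S j))
        = gen S i * x * (star (gen S i) * gen S j) * y * star (gen S j) := by
      intro j; simp only [mul_assoc]
    simp only [h, hS.star_gen_mul_gen]
    simp [mul_assoc]
  commutes' r := by
    have h := congrArg (r • ·) hS.sum_gen_mul_star
    simpa [Algebra.algebraMap_eq_smul_one, Finset.smul_sum] using h
  map_star' x := by simp [star_sum, mul_assoc]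

variable (S)

/-- The standard left inverse `Ψ_n x = (1/n) ∑ i, S_i^* x S_i`. -/
noncomputable def leftInverse : algebra S →ₗ[ℂ] algebra S where
  toFun x := (1 / (n : ℂ)) • ∑ i, star (gen S i) * x * gen S i
  map_add' x y := by simp [mul_add, add_mul, Finset.sum_add_distrib]
  map_smul' r x := by simp [← Finset.smul_sum, smul_comm r]

variable {S}

/-- The Hilbert-Schmidt form `⟨x, y⟩ = φ (y^* x)`. -/
noncomputable def hsInner (φ : algebra S →ₗ[ℂ] ℂ) (x y : algebra S) : ℂ := φ (star y * x)

/-- `Ψ` is the adjoint of `Φ` with respect to the form induced by `φ`. -/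
def IsAdjointMap (φ : algebra S →ₗ[ℂ] ℂ) (Φ Ψ : algebra S →ₗ[ℂ] algebra S) : Prop :=
  ∀ x y, hsInner φ (Φ x) y = hsInner φ x (Ψ y)

end Generators

end Cuntz

/-!
The map `Ψ = leftInverse S` is a unital positive contraction, and its iterates contract the Cuntz
algebra onto the scalars. Indeed, `Ψ` strips a common first letter off a product `S_μ S_ν^*` (up to
a factor `1/n` or `0`) and sends a nonempty word to `1/n` times its cyclic rotation. Since `n ≥ 2`,
the iterates `Ψ^k x` therefore converge to a scalar for every `x` in the dense span of the
`S_μ S_ν^*`, and, `Ψ` being a contraction, for every `x`. The limit is `φ₀ x • 1`, where `φ₀` is a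
`Ψ`-invariant state (`limitState`). This bypasses the conditional expectation of `O_n` onto its UHF
subalgebra, as well as the simplicity of `O_n`.

Every `Ψ`-invariant functional satisfies `φ (S_i a) = φ (a S_i) / n` and
`φ (a S_i^*) = φ (S_i^* a) / n` (`map_gen_mul`, `map_mul_star_gen`). Applied letter by letter, these
give the trace-like property, because the powers of `1/n` collected on the two sides agree for words
of equal length. Both the invariance of `φ₀` under `Φ = canonicalEndo` and the adjointness of `Φ`
and `Ψ` follow from `Ψ`-invariance and the module identity `Ψ (y Φ(x)) = Ψ(y) x`.

For uniqueness, `Φ^k Ψ^k x` is the average of `x` over the matrix units of `F_n^k`, so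
`φ (Φ^k Ψ^k x) = φ x` for every trace-like `φ` (`map_endo_iterate_leftInverse_iterate`). As
`Ψ^k x → φ₀ x • 1` in norm and positive functionals are bounded, `φ x = φ₀ x`.
-/

open Filter Topology

namespace Cuntz

/-! ### Positive functionals on C*-algebras -/

theorem exists_norm_le_of_nonneg_star_mul_self {A : Type*} [CStarAlgebra A] (φ : A →ₗ[ℂ] ℂ)
    (hφ : ∀ x, 0 ≤ φ (star x * x)) : ∃ C : ℝ, ∀ x, ‖φ x‖ ≤ C * ‖x‖ := by
  let := CStarAlgebra.spectralOrder A
  have := CStarAlgebra.spectralOrderedRing A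
  have hpos : ∀ x, 0 ≤ x → 0 ≤ φ x := by
    intro x hx
    obtain ⟨y, rfl⟩ := CStarAlgebra.nonneg_iff_eq_star_mul_self.mp hx
    exact hφ y
  obtain ⟨C, hC⟩ := PositiveLinearMap.exists_norm_apply_le (PositiveLinearMap.mk₀ φ hpos)
  exact ⟨C, hC⟩

variable {H : Type*} [NormedAddCommGroup H] [InnerProductSpace ℂ H] [CompleteSpace H]
  {n : ℕ} {S : Fin n → (H →L[ℂ] H)}

theorem isClosed_algebra (S : Fin n → (H →L[ℂ] H)) : IsClosed (algebra S : Set (H →L[ℂ] H)) :=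
  StarSubalgebra.isClosed_topologicalClosure _

theorem IsState.exists_norm_le {φ : algebra S →ₗ[ℂ] ℂ} (hφ : IsState S φ) :
    ∃ C : ℝ, ∀ x, ‖φ x‖ ≤ C * ‖x‖ := by
  have : IsClosed (algebra S : Set (H →L[ℂ] H)) := isClosed_algebra S
  exact exists_norm_le_of_nonneg_star_mul_self φ hφ.nonneg

theorem norm_canonicalEndo_le (hS : IsCuntzFamily S) (x : algebra S) :
    ‖canonicalEndo hS x‖ ≤ ‖x‖ := by
  have : IsClosed (algebra S : Set (H →L[ℂ] H)) := isClosed_algebra S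
  exact NonUnitalStarAlgHom.norm_apply_le (canonicalEndo hS) x

/-! ### The left inverse -/

theorem leftInverse_apply (x : algebra S) :
    leftInverse S x = (1 / (n : ℂ)) • ∑ i, star (gen S i) * x * gen S i := rfl

theorem canonicalEndo_apply (hS : IsCuntzFamily S) (x : algebra S) :
    canonicalEndo hS x = ∑ i, gen S i * x * star (gen S i) := rfl

theorem leftInverse_star (x : algebra S) : leftInverse S (star x) = star (leftInverse S x) := by
  simp [leftInverse_apply, star_sum, mul_assoc]

theorem leftInverse_iterate_star (k : ℕ) (x : algebra S) :
    (leftInverse S)^[k] (star x) = star ((leftInverse S)^[k] x) := by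
  induction k generalizing x with
  | zero => rfl
  | succ k ih => rw [Function.iterate_succ_apply, Function.iterate_succ_apply, leftInverse_star, ih]

theorem star_gen_mul_gen_mul (hS : IsCuntzFamily S) (i j : Fin n) (x : algebra S) :
    star (gen S i) * (gen S j * x) = if i = j then x else 0 := by
  rw [← mul_assoc, hS.star_gen_mul_gen]
  split_ifs <;> simp

theorem leftInverse_mul_canonicalEndo (hS : IsCuntzFamily S) (x y : algebra S) :
    leftInverse S (y * canonicalEndo hS x) = leftInverse S y * x := by
  simp only [leftInverse_apply, canonicalEndo_apply, smul_mul_assoc]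
  congr 1
  rw [Finset.sum_mul]
  refine Finset.sum_congr rfl fun i _ => ?_
  simp only [Finset.mul_sum, Finset.sum_mul, mul_assoc]
  simp [hS.star_gen_mul_gen]

theorem leftInverse_one (hS : IsCuntzFamily S) (hn : n ≠ 0) : leftInverse S 1 = 1 := by
  have : (n : ℂ) ≠ 0 := by exact_mod_cast hn
  simp [leftInverse_apply, hS.star_gen_mul_gen, ← Nat.cast_smul_eq_nsmul ℂ, smul_smul, this]

theorem leftInverse_gen_mul (hS : IsCuntzFamily S) (i : Fin n) (x : algebra S) :
    leftInverse S (gen S i * x) = (1 / (n : ℂ)) • (x * gen S i) := by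
  rw [leftInverse_apply]
  simp [star_gen_mul_gen_mul hS, ite_mul]

theorem leftInverse_mul_star_gen (hS : IsCuntzFamily S) (i : Fin n) (x : algebra S) :
    leftInverse S (x * star (gen S i)) = (1 / (n : ℂ)) • (star (gen S i) * x) := by
  have h := congrArg star (leftInverse_gen_mul hS i (star x))
  rw [← leftInverse_star] at h
  simpa using h

theorem norm_gen_le [Nontrivial H] (hS : IsCuntzFamily S) (i : Fin n) : ‖gen S i‖ ≤ 1 := by
  have h : ‖star (S i) * S i‖ = ‖S i‖ * ‖S i‖ := CStarRing.norm_star_mul_self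
  rw [hS.isometry i, norm_one] at h
  change ‖S i‖ ≤ 1
  nlinarith [norm_nonneg (S i)]

theorem norm_leftInverse_le [Nontrivial H] (hS : IsCuntzFamily S) (x : algebra S) :
    ‖leftInverse S x‖ ≤ ‖x‖ := by
  have hterm : ∀ i, ‖star (gen S i) * x * gen S i‖ ≤ ‖x‖ := by
    intro i
    calc ‖star (gen S i) * x * gen S i‖ ≤ ‖star (gen S i)‖ * ‖x‖ * ‖gen S i‖ :=
          (norm_mul_le _ _).trans (by gcongr; exact norm_mul_le _ _)
      _ ≤ 1 * ‖x‖ * 1 := by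
          rw [norm_star]
          gcongr <;> exact norm_gen_le hS i
      _ = ‖x‖ := by ring
  rw [leftInverse_apply, norm_smul]
  have hsum : ‖∑ i, star (gen S i) * x * gen S i‖ ≤ n * ‖x‖ := by
    refine (norm_sum_le _ _).trans ?_
    simpa using Finset.sum_le_sum fun i (_ : i ∈ Finset.univ) => hterm i
  rcases Nat.eq_zero_or_pos n with rfl | hn
  · simp
  · have hn' : (0 : ℝ) < n := by exact_mod_cast hn
    calc ‖(1 / (n : ℂ))‖ * ‖∑ i, star (gen S i) * x * gen S i‖
        ≤ (1 / n) * (n * ‖x‖) := by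
          rw [norm_div, norm_one, Complex.norm_natCast]
          gcongr
      _ = ‖x‖ := by field_simp

theorem norm_leftInverse_iterate_le [Nontrivial H] (hS : IsCuntzFamily S) (k : ℕ)
    (x : algebra S) : ‖(leftInverse S)^[k] x‖ ≤ ‖x‖ := by
  induction k with
  | zero => exact le_rfl
  | succ k ih =>
    rw [Function.iterate_succ_apply']
    exact (norm_leftInverse_le hS _).trans ih

/-! ### Convergence of the iterates of the left inverse -/

/-- The word `S_l` attached to a list of letters. -/
noncomputable def listWord (S : Fin n → (H →L[ℂ] H)) (l : List (Fin n)) : algebra S :=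
  (l.map (gen S)).prod

@[simp]
theorem listWord_nil : listWord S [] = 1 := rfl

@[simp]
theorem listWord_cons (i : Fin n) (l : List (Fin n)) :
    listWord S (i :: l) = gen S i * listWord S l := by simp [listWord]

theorem listWord_append_singleton (l : List (Fin n)) (i : Fin n) :
    listWord S (l ++ [i]) = listWord S l * gen S i := by simp [listWord]

theorem word_eq_listWord {k : ℕ} (μ : Fin k → Fin n) : word S μ = listWord S (List.ofFn μ) := by
  simp [word, listWord, List.map_ofFn, Function.comp_def]

/-- The span of all `S_μ S_ν^*`, with no condition on the lengths of `μ` and `ν`. -/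
noncomputable def wordSpan (S : Fin n → (H →L[ℂ] H)) : Submodule ℂ (algebra S) :=
  Submodule.span ℂ {x | ∃ μ ν : List (Fin n), x = listWord S μ * star (listWord S ν)}

theorem listWord_mul_star_mem (μ ν : List (Fin n)) :
    listWord S μ * star (listWord S ν) ∈ wordSpan S :=
  Submodule.subset_span ⟨μ, ν, rfl⟩

theorem one_mem_wordSpan : (1 : algebra S) ∈ wordSpan S := by
  simpa using listWord_mul_star_mem (S := S) [] []

theorem mul_mem_wordSpan_of_generators {a x : algebra S}
    (ha : ∀ μ ν : List (Fin n), a * (listWord S μ * star (listWord S ν)) ∈ wordSpan S)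
    (hx : x ∈ wordSpan S) : a * x ∈ wordSpan S := by
  induction hx using Submodule.span_induction with
  | mem x hx => obtain ⟨μ, ν, rfl⟩ := hx; exact ha μ ν
  | zero => simp
  | add x y _ _ hx hy => rw [mul_add]; exact add_mem hx hy
  | smul c x _ hx => rw [mul_smul_comm]; exact Submodule.smul_mem _ _ hx

theorem gen_mul_mem_wordSpan (i : Fin n) {x : algebra S} (hx : x ∈ wordSpan S) :
    gen S i * x ∈ wordSpan S := by
  refine mul_mem_wordSpan_of_generators (fun μ ν => ?_) hx
  rw [← mul_assoc, ← listWord_cons]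
  exact listWord_mul_star_mem _ _

theorem star_gen_mul_mem_wordSpan (hS : IsCuntzFamily S) (i : Fin n) {x : algebra S}
    (hx : x ∈ wordSpan S) : star (gen S i) * x ∈ wordSpan S := by
  refine mul_mem_wordSpan_of_generators (fun μ ν => ?_) hx
  cases μ with
  | nil =>
    rw [listWord_nil, one_mul, ← star_mul, ← listWord_append_singleton]
    simpa using listWord_mul_star_mem (S := S) [] (ν ++ [i])
  | cons j μ =>
    rw [listWord_cons, mul_assoc, star_gen_mul_gen_mul hS]
    split_ifs
    · exact listWord_mul_star_mem _ _
    · exact zero_mem _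

/-- The span of the `S_μ S_ν^*` is a left ideal of the *-algebra generated by the `S_i` that
contains `1`, hence it is all of this dense *-algebra. -/
theorem dense_wordSpan (hS : IsCuntzFamily S) : Dense (wordSpan S : Set (algebra S)) := by
  have key : ∀ T ∈ StarAlgebra.adjoin ℂ (Set.range S), ∃ hT : T ∈ algebra S,
      (∀ x ∈ wordSpan S, (⟨T, hT⟩ : algebra S) * x ∈ wordSpan S) ∧
      ∀ x ∈ wordSpan S, star (⟨T, hT⟩ : algebra S) * x ∈ wordSpan S := by
    intro T hT
    refine ⟨StarSubalgebra.le_topologicalClosure _ hT, ?_⟩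
    induction hT using StarAlgebra.adjoin_induction with
    | mem T h =>
      obtain ⟨i, rfl⟩ := h
      exact ⟨fun x hx => gen_mul_mem_wordSpan i hx, fun x hx => star_gen_mul_mem_wordSpan hS i hx⟩
    | algebraMap r =>
      constructor
      · intro x hx
        have h : r • x ∈ wordSpan S := Submodule.smul_mem _ _ hx
        rw [Algebra.smul_def] at h
        exact h
      · intro x hx
        have h : star r • x ∈ wordSpan S := Submodule.smul_mem _ _ hx
        rw [Algebra.smul_def, algebraMap_star_comm] at h
        exact h
    | add T U hT hU h1 h2 =>
      constructor
      · intro x hx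
        have h := add_mem (h1.1 x hx) (h2.1 x hx)
        rw [← add_mul] at h
        exact h
      · intro x hx
        have h := add_mem (h1.2 x hx) (h2.2 x hx)
        rw [← add_mul, ← star_add] at h
        exact h
    | mul T U hT hU h1 h2 =>
      constructor
      · intro x hx
        have h := h1.1 _ (h2.1 x hx)
        rw [← mul_assoc] at h
        exact h
      · intro x hx
        have h := h2.2 _ (h1.2 x hx)
        rw [← mul_assoc, ← star_mul] at h
        exact h
    | star T hT h =>
      refine ⟨fun x hx => h.2 x hx, fun x hx => ?_⟩
      have h' := h.1 x hx
      rw [← star_star (⟨T, StarSubalgebra.le_topologicalClosure _ hT⟩ : algebra S)] at h'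
      exact h'
  intro x
  rw [Topology.IsInducing.subtypeVal.closure_eq_preimage_closure_image]
  have hx : (x : H →L[ℂ] H) ∈ closure (StarAlgebra.adjoin ℂ (Set.range S) : Set (H →L[ℂ] H)) := by
    rw [← StarSubalgebra.topologicalClosure_coe]
    exact x.2
  refine closure_mono ?_ hx
  intro T hT
  obtain ⟨hT', h, -⟩ := key T hT
  exact ⟨⟨T, hT'⟩, by simpa using h 1 one_mem_wordSpan, rfl⟩

/-- The iterates `Ψ^k x` converge to the scalar `c`. -/
def LimitIs (x : algebra S) (c : ℂ) : Prop :=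
  Tendsto (fun k => (leftInverse S)^[k] x) atTop (𝓝 (c • (1 : algebra S)))

theorem LimitIs.add {x y : algebra S} {c d : ℂ} (hx : LimitIs x c) (hy : LimitIs y d) :
    LimitIs (x + y) (c + d) := by
  unfold LimitIs
  simp only [add_smul, iterate_map_add]
  exact Tendsto.add hx hy

theorem LimitIs.smul {x : algebra S} {c : ℂ} (r : ℂ) (hx : LimitIs x c) :
    LimitIs (r • x) (r * c) := by
  unfold LimitIs
  have h : ∀ k, (leftInverse S)^[k] (r • x) = r • (leftInverse S)^[k] x := by
    intro k
    rw [← Module.End.coe_pow, map_smul]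
  simp only [h, mul_smul]
  exact Tendsto.const_smul hx r

theorem LimitIs.star {x : algebra S} {c : ℂ} (hx : LimitIs x c) :
    LimitIs (star x) (star c) := by
  have h := Tendsto.star hx
  unfold LimitIs
  simpa only [leftInverse_iterate_star, star_smul, star_one] using h

theorem limitIs_leftInverse_iff {x : algebra S} {c : ℂ} :
    LimitIs (leftInverse S x) c ↔ LimitIs x c := by
  unfold LimitIs
  rw [← tendsto_add_atTop_iff_nat (f := fun k => (leftInverse S)^[k] x) 1]
  rfl

theorem limitIs_one (hS : IsCuntzFamily S) (hn : n ≠ 0) : LimitIs (1 : algebra S) 1 := by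
  have h : ∀ k, (leftInverse S)^[k] (1 : algebra S) = 1 :=
    fun k => Function.iterate_fixed (leftInverse_one hS hn) k
  simp [LimitIs, h]

theorem LimitIs.unique [Nontrivial H] {x : algebra S} {c d : ℂ} (hc : LimitIs x c)
    (hd : LimitIs x d) : c = d :=
  smul_left_injective ℂ (one_ne_zero : (1 : algebra S) ≠ 0) (tendsto_nhds_unique hc hd)

theorem norm_leftInverse_iterate_listWord_le [Nontrivial H] (hS : IsCuntzFamily S) (k : ℕ)
    (l : List (Fin n)) (hl : l ≠ []) :
    ‖(leftInverse S)^[k] (listWord S l)‖ ≤ (1 / (n : ℝ)) ^ k * ‖(1 : algebra S)‖ := by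
  induction k generalizing l with
  | zero =>
    clear hl
    simp only [Function.iterate_zero, id, pow_zero, one_mul]
    induction l with
    | nil => exact le_rfl
    | cons i l ih =>
      rw [listWord_cons]
      refine (norm_mul_le _ _).trans ?_
      calc ‖gen S i‖ * ‖listWord S l‖ ≤ 1 * ‖listWord S l‖ := by
            gcongr
            exact norm_gen_le hS i
        _ ≤ _ := by rwa [one_mul]
  | succ k ih =>
    obtain ⟨i, l, rfl⟩ := List.exists_cons_of_ne_nil hl
    rw [Function.iterate_succ_apply, listWord_cons, leftInverse_gen_mul hS,
      ← listWord_append_singleton, ← Module.End.coe_pow, map_smul, norm_smul, Module.End.coe_pow,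
      norm_div, norm_one, Complex.norm_natCast, pow_succ', mul_assoc]
    gcongr
    exact ih _ (by simp)

theorem limitIs_listWord [Nontrivial H] (hS : IsCuntzFamily S) (hn : 2 ≤ n) (l : List (Fin n))
    (hl : l ≠ []) : LimitIs (listWord S l) 0 := by
  have hn' : (1 : ℝ) < n := by exact_mod_cast hn
  have h0 : Tendsto (fun k : ℕ => (1 / (n : ℝ)) ^ k * ‖(1 : algebra S)‖) atTop (𝓝 0) := by
    simpa using (tendsto_pow_atTop_nhds_zero_of_lt_one (r := 1 / (n : ℝ)) (by positivity)
      (by rw [div_lt_one (by linarith)]; exact hn')).mul_const ‖(1 : algebra S)‖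
  unfold LimitIs
  rw [zero_smul]
  exact squeeze_zero_norm (fun k => norm_leftInverse_iterate_listWord_le hS k l hl) h0

theorem exists_limitIs_listWord_mul_star [Nontrivial H] (hS : IsCuntzFamily S) (hn : 2 ≤ n)
    (μ ν : List (Fin n)) : ∃ c, LimitIs (listWord S μ * star (listWord S ν)) c := by
  have hword : ∀ l, ∃ c, LimitIs (listWord S l) c := by
    intro l
    by_cases hl : l = []
    · subst hl
      exact ⟨1, limitIs_one hS (by omega)⟩
    · exact ⟨0, limitIs_listWord hS hn l hl⟩
  induction μ generalizing ν with
  | nil =>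
    obtain ⟨c, hc⟩ := hword ν
    exact ⟨star c, by simpa using hc.star⟩
  | cons i μ ih =>
    cases ν with
    | nil => simpa using hword (i :: μ)
    | cons j ν =>
      simp only [← limitIs_leftInverse_iff (x := listWord S (i :: μ) * _)]
      obtain ⟨c, hc⟩ := ih ν
      have h : leftInverse S (listWord S (i :: μ) * star (listWord S (j :: ν)))
          = (if j = i then 1 / (n : ℂ) else 0) • (listWord S μ * star (listWord S ν)) := by
        rw [listWord_cons, listWord_cons, star_mul, ← mul_assoc, leftInverse_mul_star_gen hS,
          mul_assoc, star_gen_mul_gen_mul hS]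
        split_ifs <;> simp
      rw [h]
      exact ⟨_, hc.smul _⟩

theorem isClosed_setOf_exists_limitIs [Nontrivial H] (hS : IsCuntzFamily S) :
    IsClosed {x : algebra S | ∃ c, LimitIs x c} := by
  refine isClosed_of_closure_subset fun x hx => ?_
  obtain ⟨u, hu, hux⟩ := mem_closure_iff_seq_limit.mp hx
  choose c hc using hu
  -- The scalar limit depends contractively on the element.
  have hdist : ∀ y z : algebra S, ∀ a b, LimitIs y a → LimitIs z b → dist a b ≤ dist y z := by
    intro y z a b ha hb
    have h := (ha.add (hb.smul (-1))).norm
    have h1 : ‖(a + -1 * b) • (1 : algebra S)‖ = dist a b := by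
      rw [norm_smul, dist_eq_norm, show ‖(1 : algebra S)‖ = ‖(1 : H →L[ℂ] H)‖ from rfl, norm_one,
        mul_one]
      congr 1
      ring
    rw [h1] at h
    refine le_of_tendsto h (Eventually.of_forall fun k => ?_)
    refine (norm_leftInverse_iterate_le hS k _).trans ?_
    rw [dist_eq_norm, neg_one_smul, sub_eq_add_neg]
  have hcauchy : CauchySeq c := by
    rw [Metric.cauchySeq_iff']
    intro ε hε
    obtain ⟨N, hN⟩ := Metric.cauchySeq_iff'.mp hux.cauchySeq ε hε
    exact ⟨N, fun m hm => (hdist _ _ _ _ (hc m) (hc N)).trans_lt (hN m hm)⟩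
  obtain ⟨d, hd⟩ := cauchySeq_tendsto_of_complete hcauchy
  refine ⟨d, ?_⟩
  -- `Ψ^k (u m) → Ψ^k x` uniformly in `k`, so the two limits may be exchanged.
  refine TendstoUniformly.tendsto_of_eventually_tendsto (p := atTop)
    (F := fun m k => (leftInverse S)^[k] (u m)) (L := fun m => c m • (1 : algebra S)) ?_
    (Eventually.of_forall hc) (hd.smul_const _)
  rw [Metric.tendstoUniformly_iff]
  intro ε hε
  filter_upwards [Metric.tendsto_nhds.mp hux ε hε] with m hm k
  rw [dist_comm, dist_eq_norm, ← iterate_map_sub]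
  refine (norm_leftInverse_iterate_le hS k _).trans_lt ?_
  rwa [← dist_eq_norm]

theorem exists_limitIs [Nontrivial H] (hS : IsCuntzFamily S) (hn : 2 ≤ n) (x : algebra S) :
    ∃ c, LimitIs x c := by
  have hn0 : n ≠ 0 := by omega
  have hspan : (wordSpan S : Set (algebra S)) ⊆ {x | ∃ c, LimitIs x c} := by
    intro x hx
    induction hx using Submodule.span_induction with
    | mem x hx =>
      obtain ⟨μ, ν, rfl⟩ := hx
      exact exists_limitIs_listWord_mul_star hS hn μ ν
    | zero => exact ⟨0 * 1, by simpa using (limitIs_one hS hn0).smul 0⟩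
    | add x y _ _ hx hy =>
      obtain ⟨c, hc⟩ := hx
      obtain ⟨d, hd⟩ := hy
      exact ⟨c + d, hc.add hd⟩
    | smul r x _ hx =>
      obtain ⟨c, hc⟩ := hx
      exact ⟨r * c, hc.smul r⟩
  exact (isClosed_setOf_exists_limitIs hS).closure_subset_iff.mpr hspan (dense_wordSpan hS x)

/-! ### The limit state -/

/-- The functional `φ₀` for which `φ₀ x • 1` is the norm limit of the iterates `Ψ^k x`. -/
noncomputable def limitState [Nontrivial H] (hS : IsCuntzFamily S) (hn : 2 ≤ n) :
    algebra S →ₗ[ℂ] ℂ where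
  toFun x := (exists_limitIs hS hn x).choose
  map_add' x y := (exists_limitIs hS hn (x + y)).choose_spec.unique
    ((exists_limitIs hS hn x).choose_spec.add (exists_limitIs hS hn y).choose_spec)
  map_smul' r x := (exists_limitIs hS hn (r • x)).choose_spec.unique
    ((exists_limitIs hS hn x).choose_spec.smul r)

theorem limitIs_limitState [Nontrivial H] (hS : IsCuntzFamily S) (hn : 2 ≤ n) (x : algebra S) :
    LimitIs x (limitState hS hn x) :=
  (exists_limitIs hS hn x).choose_spec

theorem limitState_leftInverse [Nontrivial H] (hS : IsCuntzFamily S) (hn : 2 ≤ n)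
    (x : algebra S) : limitState hS hn (leftInverse S x) = limitState hS hn x :=
  (limitIs_leftInverse_iff.mp (limitIs_limitState hS hn _)).unique (limitIs_limitState hS hn x)

theorem leftInverse_nonneg {x : algebra S} (hx : 0 ≤ (x : H →L[ℂ] H)) :
    0 ≤ (leftInverse S x : H →L[ℂ] H) := by
  have h : (leftInverse S x : H →L[ℂ] H)
      = (1 / (n : ℝ)) • ∑ i, star (S i) * (x : H →L[ℂ] H) * S i := by
    rw [← Complex.coe_smul]
    simp [leftInverse_apply, gen]
  rw [h]
  exact smul_nonneg (by positivity)
    (Finset.sum_nonneg fun i _ => star_left_conjugate_nonneg hx (S i))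

theorem isState_limitState [Nontrivial H] (hS : IsCuntzFamily S) (hn : 2 ≤ n) :
    IsState S (limitState hS hn) where
  nonneg x := by
    have hk : ∀ k, 0 ≤ (((leftInverse S)^[k] (star x * x) : algebra S) : H →L[ℂ] H) := by
      intro k
      induction k with
      | zero => exact star_mul_self_nonneg (x : H →L[ℂ] H)
      | succ k ih =>
        rw [Function.iterate_succ_apply']
        exact leftInverse_nonneg ih
    obtain ⟨v, hv⟩ := exists_ne (0 : H)
    set c := limitState hS hn (star x * x) with hc
    have h := (continuous_subtype_val.tendsto _).comp (limitIs_limitState hS hn (star x * x))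
    have h2 : Tendsto (fun k => inner ℂ v
        ((((leftInverse S)^[k] (star x * x) : algebra S) : H →L[ℂ] H) v)) atTop
        (𝓝 (inner ℂ v (((c • (1 : algebra S) : algebra S) : H →L[ℂ] H) v))) :=
      tendsto_const_nhds.inner
        (((ContinuousLinearMap.apply ℂ H v).continuous.tendsto _).comp h)
    have h3 := ge_of_tendsto' h2 fun k =>
      ((ContinuousLinearMap.nonneg_iff_isPositive _).mp (hk k)).inner_nonneg_right v
    have h4 : inner ℂ v (((c • (1 : algebra S) : algebra S) : H →L[ℂ] H) v)
        = c * ((‖v‖ ^ 2 : ℝ) : ℂ) := by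
      simp [inner_self_eq_norm_sq_to_K]
    rw [h4] at h3
    have hne : ((‖v‖ ^ 2 : ℝ) : ℂ) ≠ 0 := by
      have : ‖v‖ ^ 2 ≠ 0 := by positivity
      exact_mod_cast this
    have hinv : (0 : ℂ) ≤ (((‖v‖ ^ 2)⁻¹ : ℝ) : ℂ) := by
      have : 0 ≤ (‖v‖ ^ 2)⁻¹ := by positivity
      exact_mod_cast this
    have h5 := mul_nonneg h3 hinv
    rwa [Complex.ofReal_inv, mul_inv_cancel_right₀ hne] at h5
  map_one := (limitIs_limitState hS hn 1).unique (limitIs_one hS (by omega))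

/-! ### Functionals invariant under the left inverse -/

section Invariant

variable {φ : algebra S →ₗ[ℂ] ℂ}

theorem map_gen_mul (hS : IsCuntzFamily S) (hφ : ∀ x, φ (leftInverse S x) = φ x) (i : Fin n)
    (a : algebra S) : φ (gen S i * a) = 1 / (n : ℂ) * φ (a * gen S i) := by
  rw [← hφ, leftInverse_gen_mul hS, map_smul, smul_eq_mul]

theorem map_mul_star_gen (hS : IsCuntzFamily S) (hφ : ∀ x, φ (leftInverse S x) = φ x) (i : Fin n)
    (a : algebra S) : φ (a * star (gen S i)) = 1 / (n : ℂ) * φ (star (gen S i) * a) := by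
  rw [← hφ, leftInverse_mul_star_gen hS, map_smul, smul_eq_mul]

theorem map_listWord_mul (hS : IsCuntzFamily S) (hφ : ∀ x, φ (leftInverse S x) = φ x)
    (l : List (Fin n)) (a : algebra S) :
    φ (listWord S l * a) = (1 / (n : ℂ)) ^ l.length * φ (a * listWord S l) := by
  induction l generalizing a with
  | nil => simp
  | cons i l ih =>
    rw [listWord_cons, mul_assoc, map_gen_mul hS hφ, mul_assoc, ih, List.length_cons, pow_succ',
      mul_assoc, mul_assoc]

theorem map_mul_star_listWord (hS : IsCuntzFamily S) (hφ : ∀ x, φ (leftInverse S x) = φ x)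
    (l : List (Fin n)) (a : algebra S) :
    φ (a * star (listWord S l)) = (1 / (n : ℂ)) ^ l.length * φ (star (listWord S l) * a) := by
  induction l generalizing a with
  | nil => simp
  | cons i l ih =>
    rw [listWord_cons, star_mul, ← mul_assoc, map_mul_star_gen hS hφ, ← mul_assoc, ih,
      List.length_cons, pow_succ', mul_assoc, mul_assoc]

theorem map_mul_comm_of_mem_uhfLevel (hS : IsCuntzFamily S)
    (hφ : ∀ x, φ (leftInverse S x) = φ x) (a : algebra S) {k : ℕ} {b : algebra S}
    (hb : b ∈ uhfLevel S k) : φ (a * b) = φ (b * a) := by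
  induction hb using Submodule.span_induction with
  | mem b hb =>
    obtain ⟨μ, ν, rfl⟩ := hb
    rw [word_eq_listWord, word_eq_listWord, ← mul_assoc, map_mul_star_listWord hS hφ, mul_assoc,
      map_listWord_mul hS hφ]
    simp [mul_assoc]
  | zero => simp
  | add b c _ _ hb hc => rw [mul_add, add_mul, map_add, map_add, hb, hc]
  | smul r b _ hb => rw [mul_smul_comm, smul_mul_assoc, map_smul, map_smul, hb]

theorem isCanonicalState_of_invariant (hS : IsCuntzFamily S) (h : IsState S φ)
    (hφ : ∀ x, φ (leftInverse S x) = φ x) : IsCanonicalState S φ where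
  isState := h
  trace_like a b hb := by
    have hcont : Continuous φ := (φ.mkContinuousOfExistsBound h.exists_norm_le).continuous
    have hclosed : IsClosed {b | φ (a * b) = φ (b * a)} :=
      isClosed_eq (hcont.comp (continuous_const.mul continuous_id))
        (hcont.comp (continuous_id.mul continuous_const))
    refine hclosed.closure_subset_iff.mpr ?_ hb
    exact Set.iUnion_subset fun k b hb => map_mul_comm_of_mem_uhfLevel hS hφ a hb

theorem map_canonicalEndo_of_invariant (hS : IsCuntzFamily S) (hn : n ≠ 0)
    (hφ : ∀ x, φ (leftInverse S x) = φ x) (x : algebra S) : φ (canonicalEndo hS x) = φ x := by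
  have h := leftInverse_mul_canonicalEndo hS x 1
  rw [leftInverse_one hS hn, one_mul, one_mul] at h
  rw [← hφ, h]

theorem isAdjointMap_of_invariant (hS : IsCuntzFamily S)
    (hφ : ∀ x, φ (leftInverse S x) = φ x) :
    IsAdjointMap φ (canonicalEndo hS).toAlgHom.toLinearMap (leftInverse S) := by
  intro x y
  change φ (star y * canonicalEndo hS x) = φ (star (leftInverse S y) * x)
  rw [← hφ, leftInverse_mul_canonicalEndo, leftInverse_star]

end Invariant

/-! ### Uniqueness -/

theorem canonicalEndo_mem_uhfLevel (hS : IsCuntzFamily S) {k : ℕ} {b : algebra S}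
    (hb : b ∈ uhfLevel S k) : canonicalEndo hS b ∈ uhfLevel S (k + 1) := by
  induction hb using Submodule.span_induction with
  | mem b hb =>
    obtain ⟨μ, ν, rfl⟩ := hb
    rw [canonicalEndo_apply]
    refine Submodule.sum_mem _ fun i _ => Submodule.subset_span ⟨Fin.cons i μ, Fin.cons i ν, ?_⟩
    simp [word_eq_listWord, List.ofFn_succ, mul_assoc]
  | zero => simp
  | add b c _ _ hb hc => rw [map_add]; exact add_mem hb hc
  | smul r b _ hb => rw [map_smul]; exact Submodule.smul_mem _ _ hb

theorem gen_mul_star_gen_mem_uhfLevel (i j : Fin n) :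
    gen S i * star (gen S j) ∈ uhfLevel S 1 :=
  Submodule.subset_span ⟨fun _ => i, fun _ => j, by simp [word]⟩

/-- `Φ Ψ x` is the average of the `S_i S_j^* x S_j S_i^*`; a trace-like functional cannot
distinguish the `(i, j)` term from `x S_j S_j^*`, and these add up to `x` over `j`. -/
theorem map_canonicalEndo_leftInverse (hS : IsCuntzFamily S) (hn : n ≠ 0)
    {φ : algebra S →ₗ[ℂ] ℂ} (hφ : ∀ a, ∀ b ∈ uhfLevel S 1, φ (a * b) = φ (b * a))
    (x : algebra S) : φ (canonicalEndo hS (leftInverse S x)) = φ x := by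
  have hn' : (n : ℂ) ≠ 0 := by exact_mod_cast hn
  have hterm : ∀ i j, φ (gen S i * (star (gen S j) * x * gen S j) * star (gen S i))
      = φ (x * (gen S j * star (gen S j))) := by
    intro i j
    have h := hφ (x * (gen S j * star (gen S i))) _ (gen_mul_star_gen_mem_uhfLevel i j)
    simp only [mul_assoc] at h ⊢
    rw [← h, star_gen_mul_gen_mul hS, if_pos rfl]
  have hsum : ∑ j, φ (x * (gen S j * star (gen S j))) = φ x := by
    rw [← map_sum, ← Finset.mul_sum, hS.sum_gen_mul_star, mul_one]
  rw [canonicalEndo_apply, leftInverse_apply]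
  simp only [mul_smul_comm, smul_mul_assoc, ← Finset.smul_sum, map_smul, Finset.mul_sum,
    Finset.sum_mul, map_sum, hterm, hsum, Finset.sum_const, Finset.card_univ, Fintype.card_fin,
    nsmul_eq_mul, smul_eq_mul]
  field_simp

theorem map_endo_iterate_leftInverse_iterate (hS : IsCuntzFamily S) (hn : n ≠ 0)
    (φ : algebra S →ₗ[ℂ] ℂ) (hφ : ∀ k a, ∀ b ∈ uhfLevel S k, φ (a * b) = φ (b * a)) (k : ℕ)
    (x : algebra S) : φ ((canonicalEndo hS)^[k] ((leftInverse S)^[k] x)) = φ x := by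
  induction k generalizing φ x with
  | zero => rfl
  | succ k ih =>
    -- `φ ∘ Φ` is again trace-like, since `Φ` maps `F_n^k` into `F_n^(k+1)`.
    have h := ih (φ.comp (canonicalEndo hS).toAlgHom.toLinearMap) (fun m a b hb => by
      change φ (canonicalEndo hS (a * b)) = φ (canonicalEndo hS (b * a))
      rw [map_mul (canonicalEndo hS), map_mul (canonicalEndo hS)]
      exact hφ (m + 1) _ _ (canonicalEndo_mem_uhfLevel hS hb)) (leftInverse S x)
    rw [Function.iterate_succ_apply', Function.iterate_succ_apply]
    exact h.trans (map_canonicalEndo_leftInverse hS hn (hφ 1) x)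

theorem IsCanonicalState.eq_limitState [Nontrivial H] (hS : IsCuntzFamily S) (hn : 2 ≤ n)
    {φ : algebra S →ₗ[ℂ] ℂ} (hφ : IsCanonicalState S φ) : φ = limitState hS hn := by
  have hn0 : n ≠ 0 := by omega
  obtain ⟨C, hC⟩ := hφ.isState.exists_norm_le
  ext x
  set c := limitState hS hn x with hc
  have htr : ∀ k a, ∀ b ∈ uhfLevel S k, φ (a * b) = φ (b * a) := fun k a b hb =>
    hφ.trace_like a b (subset_closure (Set.mem_iUnion.mpr ⟨k, hb⟩))
  have hΦ : ∀ k (y : algebra S), ‖(canonicalEndo hS)^[k] y‖ ≤ ‖y‖ := by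
    intro k y
    induction k with
    | zero => exact le_rfl
    | succ k ih =>
      rw [Function.iterate_succ_apply']
      exact (norm_canonicalEndo_le hS _).trans ih
  have hfix : ∀ k, (canonicalEndo hS)^[k] (c • (1 : algebra S)) = c • (1 : algebra S) := by
    intro k
    refine Function.iterate_fixed ?_ k
    rw [map_smul, map_one]
  have hbound : ∀ k, ‖φ x - c‖ ≤ |C| * ‖(leftInverse S)^[k] x - c • (1 : algebra S)‖ := by
    intro k
    have h : φ x - c = φ ((canonicalEndo hS)^[k] ((leftInverse S)^[k] x - c • (1 : algebra S))) := by
      rw [iterate_map_sub, map_sub, hfix, map_endo_iterate_leftInverse_iterate hS hn0 φ htr,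
        map_smul, hφ.isState.map_one, smul_eq_mul, mul_one]
    rw [h]
    refine (hC _).trans ?_
    gcongr
    · exact le_abs_self C
    · exact hΦ k _
  have hlim : Tendsto (fun k => |C| * ‖(leftInverse S)^[k] x - c • (1 : algebra S)‖) atTop
      (𝓝 0) := by
    simpa [← hc] using ((limitIs_limitState hS hn x).sub_const (c • (1 : algebra S))).norm.const_mul |C|
  have h0 : ‖φ x - c‖ ≤ 0 := ge_of_tendsto' hlim hbound
  exact sub_eq_zero.mp (norm_le_zero_iff.mp h0)

end Cuntz

theorem mainTheorem5 {H : Type*} [NormedAddCommGroup H] [InnerProductSpace ℂ H] [CompleteSpace H]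
    (hH : ¬ FiniteDimensional ℂ H) (n : ℕ) (hn : 2 ≤ n)
    (S : Fin n → (H →L[ℂ] H)) (hS : Cuntz.IsCuntzFamily S) :
    (∃! φ : Cuntz.algebra S →ₗ[ℂ] ℂ, Cuntz.IsCanonicalState S φ) ∧
    ∀ φ : Cuntz.algebra S →ₗ[ℂ] ℂ, Cuntz.IsCanonicalState S φ →
      (∀ x, φ (Cuntz.canonicalEndo hS x) = φ x) ∧
      Cuntz.IsAdjointMap φ (Cuntz.canonicalEndo hS).toAlgHom.toLinearMap
        (Cuntz.leftInverse S) := by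
  have : Nontrivial H := by
    by_contra h
    rw [not_nontrivial_iff_subsingleton] at h
    exact hH inferInstance
  have hinv := Cuntz.limitState_leftInverse hS hn
  refine ⟨⟨Cuntz.limitState hS hn, Cuntz.isCanonicalState_of_invariant hS
    (Cuntz.isState_limitState hS hn) hinv, fun φ hφ => hφ.eq_limitState hS hn⟩, fun φ hφ => ?_⟩
  obtain rfl := hφ.eq_limitState hS hn
  exact ⟨Cuntz.map_canonicalEndo_of_invariant hS (by omega) hinv,
    Cuntz.isAdjointMap_of_invariant hS hinv⟩
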